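/- Let $M$ and $N$ be smooth manifolds (finite-dimensional, Hausdorff, second countable, without boundary). $C^\infty(M)$ denotes the $*$-algebra of complex-valued smooth functions with complex conjugation as involution. Let $\mathsf k$ be $\mathbb C$ or $\mathbb C[[\lambda]]$ and let $\mathcal A$, $\mathcal B$ be unital $*$-algebras over $\mathsf k$. Consider the following structure: a $(\mathcal B$-$\mathcal A)$-bimodule, i.e. a $\mathsf k$-module $\mathfrak X$ with commuting left action of $\mathcal B$ and right action of $\mathcal A$ by $\mathsf k$-linear maps (the units need not act as the identity), together with maps $\langle\cdot,\cdot\rangle_{\mathcal A}:\mathfrak X\times\mathfrak X\to\mathcal A$ and ${}_{\mathcal B}\langle\cdot,\cdot\rangle:\mathfrak X\times\mathfrak X\to\mathcal B$ such that for all $s,t\in\mathsf k$, $A\in\mathcal A$, $B\in\mathcal B$, $x,y,z\in\mathfrak X$: (E1) $\langle x,sy+tz\rangle_{\mathcal A}=s\langle x,y\rangle_{\mathcal A}+t\langle x,z\rangle_{\mathcal A}$, $\langle x,y\rangle_{\mathcal A}=\langle y,x\rangle_{\mathcal A}^*$, $\langle x,y\cdot A\rangle_{\mathcal A}=\langle x,y\rangle_{\mathcal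 A}A$, $\langle x,B\cdot y\rangle_{\mathcal A}=\langle B^*\cdot x,y\rangle_{\mathcal A}$, and the values $\langle x,y\rangle_{\mathcal A}$ span $\mathcal A$ over $\mathsf k$; (E2) ${}_{\mathcal B}\langle sx+ty,z\rangle=s\,{}_{\mathcal B}\langle x,z\rangle+t\,{}_{\mathcal B}\langle y,z\rangle$, ${}_{\mathcal B}\langle x,y\rangle={}_{\mathcal B}\langle y,x\rangle^*$, ${}_{\mathcal B}\langle B\cdot x,y\rangle=B\,{}_{\mathcal B}\langle x,y\rangle$, ${}_{\mathcal B}\langle x\cdot A,y\rangle={}_{\mathcal B}\langle x,y\cdot A^*\rangle$, and the values ${}_{\mathcal B}\langle x,y\rangle$ span $\mathcal B$ over $\mathsf k$; (E3) ${}_{\mathcal B}\langle x,y\rangle\cdot z=x\cdot\langle y,z\rangle_{\mathcal A}$. No positivity of the inner products is assumed. 1. If there is a $(C^\infty(M)$-$C^\infty(N))$-bimodule over $\mathbb C$ with this structure, then $M$ and $N$ are diffeomorphic. 2. Suppose that $M$ and $N$ are Poisson manifolds with Hermitian star products $\star_M$ and $\star_N$. Here a Hermitian star product on a Poisson manifold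 $M$ is an associative product $f\star g=\sum_{r\ge 0}\lambda^r C_r(f,g)$ on $C^\infty(M)[[\lambda]]$, $\mathbb C[[\lambda]]$-bilinear with (locally finite order) bidifferential operators $C_r$, such that $C_0(f,g)=fg$, $C_1(f,g)-C_1(g,f)=\mathrm i\{f,g\}$, $1\star f=f=f\star 1$ and $\overline{f\star g}=\overline g\star\overline f$, where $\overline\lambda=\lambda$. If there is a $(C^\infty(M)[[\lambda]],\star_M)$-$(C^\infty(N)[[\lambda]],\star_N)$-bimodule over $\mathbb C[[\lambda]]$ with this structure, then $M$ and $N$ are diffeomorphic. -/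

import Mathlib

open scoped Manifold ContDiff PowerSeries Topology

/-- The `*`-algebra `C^∞(M)` of complex-valued smooth functions on a manifold `M` modelled on
`ℝᵐ`, with pointwise operations and with complex conjugation as the involution. -/
noncomputable def SmoothFun (m : ℕ) (M : Type*) [TopologicalSpace M]
    [ChartedSpace (EuclideanSpace ℝ (Fin m)) M] : StarSubalgebra ℂ (M → ℂ) where
  carrier := {f | ContMDiff (𝓡 m) 𝓘(ℝ, ℂ) ∞ f}
  mul_mem' hf hg := by
    have h : ContDiff ℝ ∞ (fun p : ℂ × ℂ => p.1 * p.2) := contDiff_mul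
    exact h.contMDiff.comp (ContMDiff.prodMk_space hf hg)
  add_mem' hf hg := ContMDiff.add hf hg
  algebraMap_mem' c := contMDiff_const
  star_mem' hf := Complex.conjCLE.contDiff.contMDiff.comp hf

/-- A real-valued smooth function, regarded as a complex-valued one. -/
noncomputable def SmoothFun.ofReal {m : ℕ} {M : Type*} [TopologicalSpace M]
    [ChartedSpace (EuclideanSpace ℝ (Fin m)) M] (f : C^∞⟮𝓡 m, M; ℝ⟯) : SmoothFun m M :=
  ⟨fun x => (f x : ℂ), Complex.ofRealCLM.contDiff.contMDiff.comp f.contMDiff⟩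

/-- A `(B-A)`-bimodule `X` over `k` with an `A`-valued inner product `⟨·,·⟩_A` and a `B`-valued
inner product `_B⟨·,·⟩`, both full, and compatible with each other and with the two actions. No
positivity is required of the inner products, and `1` is not required to act as the identity. -/
structure InnerBimodule (k B A X : Type*) [CommRing k]
    [Ring B] [Algebra k B] [StarRing B] [Ring A] [Algebra k A] [StarRing A]
    [AddCommGroup X] [Module k X] where
  /-- the left action of `B`: `left b x = b · x` -/
  left : B →ₗ[k] Module.End k X
  left_mul : ∀ b b' x, left (b * b') x = left b (left b' x)
  /-- the right action of `A`: `right a x = x · a` -/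
  right : A →ₗ[k] Module.End k X
  right_mul : ∀ a a' x, right (a * a') x = right a' (right a x)
  left_right_comm : ∀ b a x, left b (right a x) = right a (left b x)
  /-- the `A`-valued inner product, linear in the second argument -/
  innerA : X → X → A
  innerA_linear : ∀ (s t : k) x y z,
    innerA x (s • y + t • z) = s • innerA x y + t • innerA x z
  innerA_star : ∀ x y, innerA x y = star (innerA y x)
  innerA_right : ∀ x y a, innerA x (right a y) = innerA x y * a
  innerA_left : ∀ x y b, innerA x (left b y) = innerA (left (star b) x) y
  innerA_full : Submodule.span k {a | ∃ x y, a = innerA x y} = ⊤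
  /-- the `B`-valued inner product, linear in the first argument -/
  innerB : X → X → B
  innerB_linear : ∀ (s t : k) x y z,
    innerB (s • x + t • y) z = s • innerB x z + t • innerB y z
  innerB_star : ∀ x y, innerB x y = star (innerB y x)
  innerB_left : ∀ b x y, innerB (left b x) y = b * innerB x y
  innerB_right : ∀ x y a, innerB (right a x) y = innerB x (right (star a) y)
  innerB_full : Submodule.span k {b | ∃ x y, b = innerB x y} = ⊤
  compat : ∀ x y z, left (innerB x y) z = right (innerA y z) x

section Poisson

variable (m : ℕ) (M : Type*) [TopologicalSpace M] [ChartedSpace (EuclideanSpace ℝ (Fin m)) M]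

/-- A Poisson structure on `M`, given by its Poisson bracket on real-valued smooth functions. -/
structure PoissonStructure where
  bracket : C^∞⟮𝓡 m, M; ℝ⟯ →ₗ[ℝ] C^∞⟮𝓡 m, M; ℝ⟯ →ₗ[ℝ] C^∞⟮𝓡 m, M; ℝ⟯
  skew : ∀ f g, bracket f g = -bracket g f
  leibniz : ∀ f g h, bracket f (g * h) = bracket f g * h + g * bracket f h
  jacobi : ∀ f g h,
    bracket f (bracket g h) + bracket g (bracket h f) + bracket h (bracket f g) = 0

end Poisson

section StarProduct

variable {m : ℕ} {M : Type*} [TopologicalSpace M] [ChartedSpace (EuclideanSpace ℝ (Fin m)) M]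

/-- On the set `U`, the operator `D` is a differential operator of order at most `r`: in order `0`
it is linear over the smooth functions, and in order `r + 1` all its commutators with
multiplication operators are of order at most `r`. -/
def IsDiffOpOn (U : Set M) : ℕ → (SmoothFun m M →ₗ[ℂ] SmoothFun m M) → Prop
  | 0, D => ∀ f g : SmoothFun m M, ∀ x ∈ U, (D (f * g)).1 x = f.1 x * (D g).1 x
  | r + 1, D => ∀ f : SmoothFun m M,
      IsDiffOpOn U r (D ∘ₗ LinearMap.mulLeft ℂ f - LinearMap.mulLeft ℂ f ∘ₗ D)

/-- `C` is a bidifferential operator: locally, it is a differential operator in each argument, of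
an order that does not depend on the other argument. -/
def IsBidifferential (C : SmoothFun m M →ₗ[ℂ] SmoothFun m M →ₗ[ℂ] SmoothFun m M) : Prop :=
  ∀ p : M, ∃ U ∈ 𝓝 p, ∃ r : ℕ, ∀ f, IsDiffOpOn U r (C f) ∧ IsDiffOpOn U r (C.flip f)

/-- The product `f ⋆ g = ∑_r λ^r C_r(f, g)` on `C^∞(M)[[λ]]`, where each `C_r` is extended
`ℂ[[λ]]`-bilinearly. -/
noncomputable def starMul (C : ℕ → SmoothFun m M →ₗ[ℂ] SmoothFun m M →ₗ[ℂ] SmoothFun m M)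
    (f g : (SmoothFun m M)⟦X⟧) : (SmoothFun m M)⟦X⟧ :=
  PowerSeries.mk fun n => ∑ p ∈ Finset.HasAntidiagonal.antidiagonal n,
    ∑ q ∈ Finset.HasAntidiagonal.antidiagonal p.2,
      C p.1 (PowerSeries.coeff q.1 f) (PowerSeries.coeff q.2 g)

theorem coeff_starMul (C : ℕ → SmoothFun m M →ₗ[ℂ] SmoothFun m M →ₗ[ℂ] SmoothFun m M)
    (f g : (SmoothFun m M)⟦X⟧) (n : ℕ) : PowerSeries.coeff n (starMul C f g) =
      ∑ p ∈ Finset.HasAntidiagonal.antidiagonal n,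
        ∑ q ∈ Finset.HasAntidiagonal.antidiagonal p.2,
          C p.1 (PowerSeries.coeff q.1 f) (PowerSeries.coeff q.2 g) :=
  PowerSeries.coeff_mk _ _

theorem coeff_series_smul (c : ℂ⟦X⟧) (f : (SmoothFun m M)⟦X⟧) (n : ℕ) :
    PowerSeries.coeff n (c • f) = ∑ p ∈ Finset.HasAntidiagonal.antidiagonal n,
      PowerSeries.coeff p.1 c • PowerSeries.coeff p.2 f := by
  rw [Algebra.smul_def, PowerSeries.algebraMap_apply'', PowerSeries.coeff_mul]
  simp [Algebra.smul_def]

theorem starMul_smul_left (C : ℕ → SmoothFun m M →ₗ[ℂ] SmoothFun m M →ₗ[ℂ] SmoothFun m M)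
    (c : ℂ⟦X⟧) (f g : (SmoothFun m M)⟦X⟧) : starMul C (c • f) g = c • starMul C f g := by
  ext1 n
  simp only [coeff_starMul, coeff_series_smul, map_sum, LinearMap.sum_apply, map_smul,
    LinearMap.smul_apply, Finset.smul_sum, Finset.sum_sigma']
  refine Finset.sum_nbij'
    (fun x => ⟨(x.2.2.1, x.1.1 + x.2.2.2 + x.2.1.2), (x.1.1, x.2.2.2 + x.2.1.2),
      (x.2.2.2, x.2.1.2)⟩)
    (fun x => ⟨(x.2.1.1, x.1.1 + x.2.2.1 + x.2.2.2), (x.1.1 + x.2.2.1, x.2.2.2),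
      (x.1.1, x.2.2.1)⟩) ?_ ?_ ?_ ?_ ?_
  · rintro ⟨⟨a, b⟩, ⟨c, d⟩, ⟨e, f⟩⟩ h
    simp at h ⊢
    omega
  · rintro ⟨⟨a, b⟩, ⟨c, d⟩, ⟨e, f⟩⟩ h
    simp at h ⊢
    omega
  · rintro ⟨⟨a, b⟩, ⟨c, d⟩, ⟨e, f⟩⟩ h
    simp at h ⊢
    omega
  · rintro ⟨⟨a, b⟩, ⟨c, d⟩, ⟨e, f⟩⟩ h
    simp at h ⊢
    omega
  · rintro ⟨⟨a, b⟩, ⟨c, d⟩, ⟨e, f⟩⟩ h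
    rfl

theorem starMul_smul_right (C : ℕ → SmoothFun m M →ₗ[ℂ] SmoothFun m M →ₗ[ℂ] SmoothFun m M)
    (c : ℂ⟦X⟧) (f g : (SmoothFun m M)⟦X⟧) : starMul C f (c • g) = c • starMul C f g := by
  ext1 n
  simp only [coeff_starMul, coeff_series_smul, map_sum, map_smul, Finset.smul_sum,
    Finset.sum_sigma']
  refine Finset.sum_nbij'
    (fun x => ⟨(x.2.2.1, x.1.1 + x.2.1.1 + x.2.2.2), (x.1.1, x.2.1.1 + x.2.2.2),
      (x.2.1.1, x.2.2.2)⟩)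
    (fun x => ⟨(x.2.1.1, x.2.2.1 + x.1.1 + x.2.2.2), (x.2.2.1, x.1.1 + x.2.2.2),
      (x.1.1, x.2.2.2)⟩) ?_ ?_ ?_ ?_ ?_
  · rintro ⟨⟨a, b⟩, ⟨c, d⟩, ⟨e, f⟩⟩ h
    simp at h ⊢
    omega
  · rintro ⟨⟨a, b⟩, ⟨c, d⟩, ⟨e, f⟩⟩ h
    simp at h ⊢
    omega
  · rintro ⟨⟨a, b⟩, ⟨c, d⟩, ⟨e, f⟩⟩ h
    simp at h ⊢
    omega
  · rintro ⟨⟨a, b⟩, ⟨c, d⟩, ⟨e, f⟩⟩ h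
    simp at h ⊢
    omega
  · rintro ⟨⟨a, b⟩, ⟨c, d⟩, ⟨e, f⟩⟩ h
    rfl

theorem starMul_add_left (C : ℕ → SmoothFun m M →ₗ[ℂ] SmoothFun m M →ₗ[ℂ] SmoothFun m M)
    (f g h : (SmoothFun m M)⟦X⟧) : starMul C (f + g) h = starMul C f h + starMul C g h := by
  ext1 n
  simp [coeff_starMul, Finset.sum_add_distrib]

theorem starMul_add_right (C : ℕ → SmoothFun m M →ₗ[ℂ] SmoothFun m M →ₗ[ℂ] SmoothFun m M)
    (f g h : (SmoothFun m M)⟦X⟧) : starMul C f (g + h) = starMul C f g + starMul C f h := by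
  ext1 n
  simp [coeff_starMul, Finset.sum_add_distrib]

/-- Complex conjugation on `C^∞(M)[[λ]]`, where `λ` is real: every coefficient is conjugated. -/
noncomputable def seriesConj (f : (SmoothFun m M)⟦X⟧) : (SmoothFun m M)⟦X⟧ :=
  PowerSeries.mk fun n => star (PowerSeries.coeff n f)

theorem seriesConj_seriesConj (f : (SmoothFun m M)⟦X⟧) : seriesConj (seriesConj f) = f := by
  ext1 n
  simp [seriesConj]

theorem seriesConj_add (f g : (SmoothFun m M)⟦X⟧) :
    seriesConj (f + g) = seriesConj f + seriesConj g := by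
  ext1 n
  simp [seriesConj]

/-- A Hermitian star product on the Poisson manifold `(M, P)`: a formal associative deformation of
the pointwise product by bidifferential operators, with unit `1`, whose commutator in first order is
`i` times the Poisson bracket (on real functions, hence on all by `ℂ`-bilinear extension), and for
which complex conjugation (with `λ` real) is an involution. -/
structure HermitianStarProduct (P : PoissonStructure m M) where
  C : ℕ → SmoothFun m M →ₗ[ℂ] SmoothFun m M →ₗ[ℂ] SmoothFun m M
  bidifferential : ∀ r, IsBidifferential (C r)
  zeroth : ∀ f g, C 0 f g = f * g
  first : ∀ f g : C^∞⟮𝓡 m, M; ℝ⟯,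
    C 1 (SmoothFun.ofReal f) (SmoothFun.ofReal g) - C 1 (SmoothFun.ofReal g) (SmoothFun.ofReal f)
      = Complex.I • SmoothFun.ofReal (P.bracket f g)
  one_left : ∀ r, 0 < r → ∀ f, C r 1 f = 0
  one_right : ∀ r, 0 < r → ∀ f, C r f 1 = 0
  assoc : ∀ f g h, starMul C (starMul C f g) h = starMul C f (starMul C g h)
  hermitian : ∀ f g, seriesConj (starMul C f g) = starMul C (seriesConj g) (seriesConj f)

/-- The `*`-algebra `(C^∞(M)[[λ]], ⋆)` over `ℂ[[λ]]`. -/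
def HermitianStarProduct.Alg {P : PoissonStructure m M} (_S : HermitianStarProduct P) : Type _ :=
  (SmoothFun m M)⟦X⟧

namespace HermitianStarProduct

variable {P : PoissonStructure m M} (S : HermitianStarProduct P)

noncomputable instance : AddCommGroup S.Alg := inferInstanceAs (AddCommGroup (SmoothFun m M)⟦X⟧)

noncomputable instance : Module ℂ⟦X⟧ S.Alg :=
  inferInstanceAs (Module ℂ⟦X⟧ (SmoothFun m M)⟦X⟧)

theorem starMul_one (f : (SmoothFun m M)⟦X⟧) : starMul S.C f 1 = f := by
  ext1 n
  rw [coeff_starMul, Finset.sum_eq_single (0, n), Finset.sum_eq_single (n, 0)]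
  · simp [S.zeroth]
  · rintro ⟨a, b⟩ h hne
    have hb : b ≠ 0 := by rintro rfl; simp at h hne; omega
    simp [PowerSeries.coeff_one, hb]
  · simp
  · rintro ⟨a, b⟩ h hne
    have ha : 0 < a := by
      rcases Nat.eq_zero_or_pos a with rfl | ha
      · simp at h hne; omega
      · exact ha
    refine Finset.sum_eq_zero fun q _ => ?_
    rw [PowerSeries.coeff_one]
    split_ifs
    · exact S.one_right a ha _
    · simp
  · simp

theorem one_starMul (f : (SmoothFun m M)⟦X⟧) : starMul S.C 1 f = f := by
  ext1 n
  rw [coeff_starMul, Finset.sum_eq_single (0, n), Finset.sum_eq_single (0, n)]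
  · simp [S.zeroth]
  · rintro ⟨a, b⟩ h hne
    have hb : a ≠ 0 := by rintro rfl; simp at h hne; omega
    simp [PowerSeries.coeff_one, hb]
  · simp
  · rintro ⟨a, b⟩ h hne
    have ha : 0 < a := by
      rcases Nat.eq_zero_or_pos a with rfl | ha
      · simp at h hne; omega
      · exact ha
    refine Finset.sum_eq_zero fun q _ => ?_
    rw [PowerSeries.coeff_one]
    split_ifs
    · exact S.one_left a ha _
    · simp
  · simp

/-- The ring structure: formal series are added coefficientwise and multiplied with `⋆`. -/
noncomputable instance : Ring S.Alg :=
  { (inferInstance : AddCommGroup S.Alg) with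
    mul := starMul S.C
    one := (1 : (SmoothFun m M)⟦X⟧)
    mul_assoc := S.assoc
    one_mul := S.one_starMul
    mul_one := S.starMul_one
    left_distrib := starMul_add_right S.C
    right_distrib := fun f g h => starMul_add_left S.C f g h
    zero_mul := fun f => by
      have h := starMul_smul_left S.C 0 0 f
      rwa [zero_smul, zero_smul] at h
    mul_zero := fun f => by
      have h := starMul_smul_right S.C 0 f 0
      rwa [zero_smul, zero_smul] at h }

noncomputable instance : Algebra ℂ⟦X⟧ S.Alg :=
  Algebra.ofModule (fun c f g => starMul_smul_left S.C c f g)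
    (fun c f g => starMul_smul_right S.C c f g)

/-- The involution: complex conjugation of every coefficient. -/
noncomputable instance : StarRing S.Alg where
  star := seriesConj
  star_involutive := seriesConj_seriesConj
  star_mul := S.hermitian
  star_add := seriesConj_add

end HermitianStarProduct

end StarProduct

/-! Over commutative algebras, such a bimodule makes the two algebras act on `X` by the same
operators. By (E3), an operator `b` of `B` acts on `x · ⟨y, z⟩` as right multiplication by `⟨y, b ·
z⟩`; fullness extends this to every element of `A`, in particular to `1`, so `b` acts as some `a`
(`exists_right_eq_left`), and symmetrically (`exists_left_eq_right`). Fullness also makes both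
actions faithful, so `b ↦ a` is an algebra isomorphism (`nonempty_algEquiv`).

Every character of `C^∞(M)` is evaluation at a point (`SmoothFun.exists_eq_eval`), so an isomorphism
of function algebras is pullback along a bijection; it is smooth in both directions because it pulls
smooth functions back to smooth functions (`contMDiff_of_forall_smoothFun`). This settles the
undeformed case.

For star products everything is reduced modulo `λ`: `X / λX` inherits the whole structure over the
undeformed algebras (`classicalLimit`), fullness included, and the undeformed case applies. -/

namespace InnerBimodule

/-! ### Units and faithfulness of the two actions -/

section Basic

variable {k B A X : Type*} [CommRing k] [Ring B] [Algebra k B] [StarRing B] [Ring A]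
  [Algebra k A] [StarRing A] [AddCommGroup X] [Module k X] (E : InnerBimodule k B A X)

theorem innerA_zero_right (x : X) : E.innerA x 0 = 0 := by
  simpa using E.innerA_linear 0 0 x 0 0

theorem innerB_zero_left (x : X) : E.innerB 0 x = 0 := by
  simpa using E.innerB_linear 0 0 0 0 x

theorem innerA_add_right (x y z : X) : E.innerA x (y + z) = E.innerA x y + E.innerA x z := by
  simpa using E.innerA_linear 1 1 x y z

theorem innerB_add_left (x y z : X) : E.innerB (x + y) z = E.innerB x z + E.innerB y z := by
  simpa using E.innerB_linear 1 1 x y z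

theorem innerA_smul_right (s : k) (x y : X) : E.innerA x (s • y) = s • E.innerA x y := by
  simpa using E.innerA_linear s 0 x y 0

theorem innerB_smul_left (s : k) (x y : X) : E.innerB (s • x) y = s • E.innerB x y := by
  simpa using E.innerB_linear s 0 x 0 y

/-- To prove a property of all elements of `A`, it suffices to check it on inner products. -/
theorem inductionA {p : A → Prop} (inner : ∀ x y, p (E.innerA x y))
    (add : ∀ a a', p a → p a' → p (a + a')) (smul : ∀ (s : k) a, p a → p (s • a)) (a : A) :
    p a := by
  have h : a ∈ Submodule.span k {a | ∃ x y, a = E.innerA x y} := E.innerA_full ▸ trivial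
  induction h using Submodule.span_induction with
  | mem a h => obtain ⟨x, y, rfl⟩ := h; exact inner x y
  | zero => simpa [innerA_zero_right] using inner 0 0
  | add a a' _ _ h h' => exact add a a' h h'
  | smul s a _ h => exact smul s a h

/-- To prove a property of all elements of `B`, it suffices to check it on inner products. -/
theorem inductionB {p : B → Prop} (inner : ∀ x y, p (E.innerB x y))
    (add : ∀ b b', p b → p b' → p (b + b')) (smul : ∀ (s : k) b, p b → p (s • b)) (b : B) :
    p b := by
  have h : b ∈ Submodule.span k {b | ∃ x y, b = E.innerB x y} := E.innerB_full ▸ trivial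
  induction h using Submodule.span_induction with
  | mem b h => obtain ⟨x, y, rfl⟩ := h; exact inner x y
  | zero => simpa [innerB_zero_left] using inner 0 0
  | add b b' _ _ h h' => exact add b b' h h'
  | smul s b _ h => exact smul s b h

/-- By (E3) and fullness, the unit of `B` fixes every `z · c`, and the unit of `A` fixes every `d ·
z`. The two units therefore act by commuting projections, each of which fixes the image of the
other, so the projections coincide. -/
theorem left_one (z : X) : E.left 1 z = E.right 1 z := by
  have h₁ : ∀ (c : A) (z : X), E.left 1 (E.right c z) = E.right c z := by
    refine E.inductionA (fun x y z => ?_) (fun a a' h h' z => ?_) (fun s a h z => ?_)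
    · rw [← E.compat, ← E.left_mul, one_mul]
    · simp [h, h']
    · simp [h]
  have h₂ : ∀ (d : B) (z : X), E.right 1 (E.left d z) = E.left d z := by
    refine E.inductionB (fun x y z => ?_) (fun a a' h h' z => ?_) (fun s a h z => ?_)
    · rw [E.compat, ← E.right_mul, mul_one]
    · simp [h, h']
    · simp [h]
  rw [← h₂, ← E.left_right_comm, h₁]

/-- If `a` acts as zero then `⟨x, y⟩ a = ⟨x, y · a⟩ = 0`, so fullness gives `c a = 0` for all `c`,
and `c = 1` gives `a = 0`. -/
theorem right_injective : Function.Injective E.right := by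
  rw [injective_iff_map_eq_zero]
  intro a ha
  have h : ∀ c : A, c * a = 0 := by
    refine E.inductionA (fun x y => ?_) (fun c c' h h' => ?_) (fun s c h => ?_)
    · rw [← E.innerA_right, ha, LinearMap.zero_apply, innerA_zero_right]
    · rw [add_mul, h, h', add_zero]
    · rw [smul_mul_assoc, h, smul_zero]
  simpa using h 1

theorem left_injective : Function.Injective E.left := by
  rw [injective_iff_map_eq_zero]
  intro b hb
  have h : ∀ c : B, b * c = 0 := by
    refine E.inductionB (fun x y => ?_) (fun c c' h h' => ?_) (fun s c h => ?_)
    · rw [← E.innerB_left, hb, LinearMap.zero_apply, innerB_zero_left]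
    · rw [mul_add, h, h', add_zero]
    · rw [mul_smul_comm, h, smul_zero]
  simpa using h 1

end Basic

/-! ### Commutative algebras: the bimodule gives an isomorphism -/

section Commutative

variable {k B A X : Type*} [CommRing k] [CommRing B] [Algebra k B] [StarRing B] [CommRing A]
  [Algebra k A] [StarRing A] [AddCommGroup X] [Module k X] (E : InnerBimodule k B A X)

/-- Multiplying by `c` first makes (E3) available: for `c = ⟨x, y⟩` the element `⟨x, b · y⟩` works,
since `b` commutes with the values of `innerB`. Taking `c = 1` leaves the projection `right 1`,
which `left_one` absorbs into `b`. -/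
theorem exists_right_eq_left (b : B) : ∃ a, E.right a = E.left b := by
  have h : ∀ c : A, ∃ a, ∀ z, E.right a z = E.left b (E.right c z) := by
    refine E.inductionA (fun x y => ⟨E.innerA x (E.left b y), fun z => ?_⟩) ?_ ?_
    · rw [← E.compat, ← E.compat, ← E.left_mul, ← E.left_mul, mul_comm]
    · rintro c c' ⟨a, h⟩ ⟨a', h'⟩
      exact ⟨a + a', fun z => by simp [h, h']⟩
    · rintro s c ⟨a, h⟩
      exact ⟨s • a, fun z => by simp [h]⟩
  obtain ⟨a, ha⟩ := h 1
  refine ⟨a, LinearMap.ext fun z => ?_⟩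
  rw [ha, ← left_one, ← E.left_mul, mul_one]

theorem exists_left_eq_right (a : A) : ∃ b, E.left b = E.right a := by
  have h : ∀ c : B, ∃ b, ∀ z, E.left b z = E.right a (E.left c z) := by
    refine E.inductionB (fun x y => ⟨E.innerB (E.right a x) y, fun z => ?_⟩) ?_ ?_
    · rw [E.compat, E.compat, ← E.right_mul, ← E.right_mul, mul_comm]
    · rintro c c' ⟨a, h⟩ ⟨a', h'⟩
      exact ⟨a + a', fun z => by simp [h, h']⟩
    · rintro s c ⟨a, h⟩
      exact ⟨s • a, fun z => by simp [h]⟩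
  obtain ⟨b, hb⟩ := h 1
  refine ⟨b, LinearMap.ext fun z => ?_⟩
  rw [hb, left_one, ← E.right_mul, one_mul]

/-- Commutative algebras related by a full inner product bimodule are isomorphic: the isomorphism
sends `b` to the unique `a` with `b · x = x · a` for all `x`. -/
theorem nonempty_algEquiv (E : InnerBimodule k B A X) : Nonempty (B ≃ₐ[k] A) := by
  choose f hf using E.exists_right_eq_left
  have key : ∀ b a, (∀ z, E.right a z = E.left b z) → f b = a := fun b a h =>
    E.right_injective ((hf b).trans (LinearMap.ext fun z => (h z).symm))
  have hf' : ∀ b z, E.right (f b) z = E.left b z := fun b z => by rw [hf]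
  let φ : B →ₗ[k] A :=
    { toFun := f
      map_add' := fun b b' => key _ _ fun z => by simp [hf']
      map_smul' := fun s b => key _ _ fun z => by simp [hf'] }
  have hone : φ 1 = 1 := key _ _ fun z => (E.left_one z).symm
  have hmul : ∀ b b', φ (b * b') = φ b * φ b' := fun b b' => key _ _ fun z => by
    change E.right (f b * f b') z = _
    -- A right action reverses products; commutativity of `A` undoes the reversal.
    rw [mul_comm, E.right_mul, hf', E.left_mul, hf']
  refine ⟨AlgEquiv.ofBijective (AlgHom.ofLinearMap φ hone hmul) ⟨fun b b' h => ?_, fun a => ?_⟩⟩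
  · exact E.left_injective (by rw [← hf, ← hf]; exact congrArg E.right h)
  · obtain ⟨b, hb⟩ := E.exists_left_eq_right a
    exact ⟨b, key _ _ fun z => by rw [hb]⟩

end Commutative

end InnerBimodule

/-! ### Recovering a manifold from its algebra of smooth functions -/

section Geometry

variable {m : ℕ} {M : Type*} [TopologicalSpace M] [ChartedSpace (EuclideanSpace ℝ (Fin m)) M]

/-- A nowhere vanishing smooth function is invertible. -/
theorem SmoothFun.isUnit_of_forall_ne_zero {f : SmoothFun m M} (hf : ∀ x, f.1 x ≠ 0) :
    IsUnit f := by
  have hsm : ContMDiff (𝓡 m) 𝓘(ℝ, ℂ) ∞ fun x => (f.1 x)⁻¹ := fun x =>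
    ((contDiffAt_inv ℝ (hf x)).contMDiffAt (n := ∞)).comp x (f.2 x)
  refine IsUnit.of_mul_eq_one (⟨fun x => (f.1 x)⁻¹, hsm⟩ : SmoothFun m M) ?_
  ext x
  exact mul_inv_cancel₀ (hf x)

variable [IsManifold (𝓡 m) ∞ M] [T2Space M]

/-- Smooth functions separate points from neighbourhoods. -/
theorem SmoothFun.exists_eq_one_of_mem_nhds {x : M} {U : Set M} (hU : U ∈ 𝓝 x) :
    ∃ f : SmoothFun m M, f.1 x = 1 ∧ ∀ y, f.1 y ≠ 0 → y ∈ U := by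
  obtain ⟨g, -, hg⟩ := (SmoothBumpFunction.nhds_basis_tsupport (I := 𝓡 m) x).mem_iff.1 hU
  refine ⟨SmoothFun.ofReal ⟨g, g.contMDiff⟩, ?_, fun y hy => hg (subset_tsupport _ ?_)⟩
  · simp [SmoothFun.ofReal]
  · simpa [SmoothFun.ofReal] using hy

theorem SmoothFun.eq_of_forall_eq {x y : M} (h : ∀ f : SmoothFun m M, f.1 x = f.1 y) :
    x = y := by
  by_contra hne
  obtain ⟨f, hf, hU⟩ := SmoothFun.exists_eq_one_of_mem_nhds (m := m)
    (isOpen_ne.mem_nhds hne : {z | z ≠ y} ∈ 𝓝 x)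
  exact hU y (by rw [← h, hf]; exact one_ne_zero) rfl

/-- A map with smooth pullbacks of smooth functions is smooth. -/
theorem contMDiff_of_forall_smoothFun {n : ℕ} {N : Type*} [TopologicalSpace N]
    [ChartedSpace (EuclideanSpace ℝ (Fin n)) N] {F : N → M}
    (h : ∀ f : SmoothFun m M, ContMDiff (𝓡 n) 𝓘(ℝ, ℂ) ∞ (f.1 ∘ F)) :
    ContMDiff (𝓡 n) (𝓡 m) ∞ F := by
  have hc : Continuous F := continuous_iff_continuousAt.2 fun y U hU => by
    obtain ⟨f, hf, hfU⟩ := SmoothFun.exists_eq_one_of_mem_nhds (m := m) hU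
    have : ∀ᶠ z in 𝓝 y, (f.1 ∘ F) z ≠ 0 :=
      (h f).continuous.continuousAt.eventually_ne (by simp [hf])
    exact this.mono fun z hz => hfU _ hz
  intro y
  rw [contMDiffAt_iff_target]
  refine ⟨hc.continuousAt, ?_⟩
  -- Cutting the chart off by a bump function makes its coordinates global smooth functions, to
  -- which `h` applies; near `F y` the cutoff equals `1`.
  let g : SmoothBumpFunction (𝓡 m) (F y) := Classical.arbitrary _
  have hg : ContMDiff (𝓡 m) 𝓘(ℝ, EuclideanSpace ℝ (Fin m)) ∞
      fun x => g x • extChartAt (𝓡 m) (F y) x := g.contMDiff_smul contMDiffOn_extChartAt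
  have hgF : ContMDiff (𝓡 n) 𝓘(ℝ, EuclideanSpace ℝ (Fin m)) ∞
      fun z => g (F z) • extChartAt (𝓡 m) (F y) (F z) := by
    have hi : ∀ i, ContMDiff (𝓡 n) 𝓘(ℝ, ℝ) ∞
        fun z => (g (F z) • extChartAt (𝓡 m) (F y) (F z)) i := fun i => by
      have h₁ : ContMDiff (𝓡 m) 𝓘(ℝ, ℝ) ∞ fun x => (g x • extChartAt (𝓡 m) (F y) x) i :=
        (EuclideanSpace.proj (𝕜 := ℝ) i).contDiff.contMDiff.comp hg
      exact Complex.reCLM.contDiff.contMDiff.comp (h (SmoothFun.ofReal ⟨_, h₁⟩))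
    have hpi : ContMDiff (𝓡 n) 𝓘(ℝ, Fin m → ℝ) ∞
        fun z i => (g (F z) • extChartAt (𝓡 m) (F y) (F z)) i := contMDiff_pi_space.2 hi
    exact (EuclideanSpace.equiv (Fin m) ℝ).symm.contDiff.contMDiff.comp hpi
  refine (hgF y).congr_of_eventuallyEq ?_
  filter_upwards [hc.continuousAt.eventually g.eventuallyEq_one] with z hz
  simp [hz]

variable [SecondCountableTopology M]

/-- A smooth function on `M` whose fibres are compact. -/
theorem SmoothFun.exists_isCompact_fiber :
    ∃ f : SmoothFun m M, ∀ c : ℂ, IsCompact {x | f.1 x = c} := by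
  have := Manifold.locallyCompact_of_finiteDimensional (M := M) (𝓡 m)
  have : SigmaCompactSpace M := sigmaCompactSpace_of_locallyCompact_secondCountable
  let K : CompactExhaustion M := default
  obtain ⟨g, hg⟩ := exists_contMDiffMap_forall_mem_convex_of_local_const (n := ⊤) (𝓡 m)
    (t := fun x => Set.Ici (K.find x : ℝ)) (fun x => convex_Ici _) fun x => by
      -- `K.find` may jump near `x`, but it is at most `K.find x + 1` on the interior of the next
      -- compact set of the exhaustion.
      refine ⟨(K.find x + 1 : ℕ), ?_⟩
      filter_upwards [mem_interior_iff_mem_nhds.1 (K.subset_interior_succ _ (K.mem_find x))]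
        with y hy
      exact Set.mem_Ici.2 <| Nat.cast_le.2 (K.mem_iff_find_le.1 hy)
  refine ⟨SmoothFun.ofReal g, fun c => ?_⟩
  refine (K.isCompact ⌈c.re⌉₊).of_isClosed_subset ?_ fun x hx => ?_
  · exact isClosed_eq (Complex.continuous_ofReal.comp g.contMDiff.continuous) continuous_const
  · have hx : ((g x : ℝ) : ℂ) = c := hx
    have h : (K.find x : ℝ) ≤ g x := hg x
    rw [K.mem_iff_find_le, ← Nat.cast_le (α := ℝ)]
    refine h.trans ?_
    rw [← hx]
    exact Nat.le_ceil _

/-- Characters of the algebra of smooth functions are evaluations at points. -/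
theorem SmoothFun.exists_eq_eval (χ : SmoothFun m M →ₐ[ℂ] ℂ) :
    ∃ x, ∀ f : SmoothFun m M, χ f = f.1 x := by
  by_contra! hcon
  have hker : ∀ x, ∃ f : SmoothFun m M, χ f = 0 ∧ f.1 x ≠ 0 := fun x => by
    obtain ⟨f, hf⟩ := hcon x
    -- Subtracting the constant `χ f` moves a witness of `χ ≠ ev_x` into the kernel of `χ`.
    refine ⟨f - algebraMap ℂ _ (χ f), by simp, ?_⟩
    exact sub_ne_zero.2 hf.symm
  choose k hk hkx using hker
  obtain ⟨p, hp⟩ := SmoothFun.exists_isCompact_fiber (m := m) (M := M)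
  obtain ⟨t, -, ht⟩ := (hp (χ p)).elim_nhds_subcover (fun x => {y | (k x).1 y ≠ 0})
    fun x _ => (k x).2.continuous.continuousAt.eventually_ne (hkx x)
  let q : SmoothFun m M := p - algebraMap ℂ _ (χ p)
  -- Each summand has a factor in the kernel of `χ`, so `χ s = 0`. Yet `s > 0` everywhere: off the
  -- compact fibre `q` is nonzero, and on it some `k x` with `x ∈ t` is. Thus `s` is invertible, a
  -- contradiction.
  let s : SmoothFun m M := star q * q + ∑ x ∈ t, star (k x) * k x
  have hs : χ s = 0 := by simp [s, q, hk]
  have hval : ∀ y, s.1 y = ((‖q.1 y‖ ^ 2 + ∑ x ∈ t, ‖(k x).1 y‖ ^ 2 : ℝ) : ℂ) := fun y => by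
    have h : ∀ f : SmoothFun m M, (star f * f).1 y = ((‖f.1 y‖ ^ 2 : ℝ) : ℂ) := fun f => by
      rw [Complex.ofReal_pow, ← Complex.conj_mul']
      rfl
    have h' : s.1 y = (star q * q).1 y + ∑ x ∈ t, (star (k x) * k x).1 y := by
      simp [s]
    rw [h', h, Finset.sum_congr rfl fun x _ => h (k x)]
    push_cast
    rfl
  have hne : ∀ y, s.1 y ≠ 0 := fun y hy => by
    rw [hval, Complex.ofReal_eq_zero,
      add_eq_zero_iff_of_nonneg (by positivity) (by positivity),
      Finset.sum_eq_zero_iff_of_nonneg fun _ _ => by positivity] at hy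
    have hq : q.1 y = 0 := by simpa using hy.1
    have hy' : y ∈ {x | p.1 x = χ p} := sub_eq_zero.1 hq
    obtain ⟨x, hx, hxy⟩ := Set.mem_iUnion₂.1 (ht hy')
    exact hxy (by simpa using hy.2 x hx)
  exact ((SmoothFun.isUnit_of_forall_ne_zero hne).map χ).ne_zero hs

/-- An isomorphism of the algebras of smooth functions comes from a diffeomorphism. -/
theorem SmoothFun.nonempty_diffeomorph {n : ℕ} {N : Type*} [TopologicalSpace N]
    [ChartedSpace (EuclideanSpace ℝ (Fin n)) N] [IsManifold (𝓡 n) ∞ N] [T2Space N]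
    [SecondCountableTopology N] (φ : SmoothFun m M ≃ₐ[ℂ] SmoothFun n N) :
    Nonempty (M ≃ₘ⟮𝓡 m, 𝓡 n⟯ N) := by
  let evM (x : M) : SmoothFun m M →ₐ[ℂ] ℂ :=
    (Pi.evalAlgHom ℂ (fun _ : M => ℂ) x).comp (SmoothFun m M).toSubalgebra.val
  let evN (y : N) : SmoothFun n N →ₐ[ℂ] ℂ :=
    (Pi.evalAlgHom ℂ (fun _ : N => ℂ) y).comp (SmoothFun n N).toSubalgebra.val
  choose F hF using fun y => SmoothFun.exists_eq_eval ((evN y).comp φ.toAlgHom)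
  choose G hG using fun x => SmoothFun.exists_eq_eval ((evM x).comp φ.symm.toAlgHom)
  have hF : ∀ y f, (φ f).1 y = f.1 (F y) := hF
  have hG : ∀ x f, (φ.symm f).1 x = f.1 (G x) := hG
  refine ⟨⟨⟨G, F, fun x => ?_, fun y => ?_⟩, ?_, ?_⟩⟩
  · refine SmoothFun.eq_of_forall_eq (m := m) fun f => ?_
    rw [← hF, ← hG, φ.symm_apply_apply]
  · refine SmoothFun.eq_of_forall_eq (m := n) fun f => ?_
    rw [← hG, ← hF, φ.apply_symm_apply]
  · exact contMDiff_of_forall_smoothFun fun f =>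
      (φ.symm f).2.congr fun x => (hG x f).symm
  · exact contMDiff_of_forall_smoothFun fun f => (φ f).2.congr fun x => (hF x f).symm

end Geometry

/-! ### Reduction of modules and algebras modulo `λ` -/

/-- The classical limit `X / λX` of a module over `ℂ[[λ]]`. -/
def ClassicalLimit (X : Type*) [AddCommGroup X] [Module ℂ⟦X⟧ X] : Type _ :=
  X ⧸ LinearMap.range (LinearMap.lsmul ℂ⟦X⟧ X PowerSeries.X)

namespace ClassicalLimit

variable {X : Type*} [AddCommGroup X] [Module ℂ⟦X⟧ X]

noncomputable instance : AddCommGroup (ClassicalLimit X) :=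
  inferInstanceAs (AddCommGroup (X ⧸ LinearMap.range (LinearMap.lsmul ℂ⟦X⟧ X PowerSeries.X)))

noncomputable instance : Module ℂ⟦X⟧ (ClassicalLimit X) :=
  inferInstanceAs (Module ℂ⟦X⟧ (X ⧸ LinearMap.range (LinearMap.lsmul ℂ⟦X⟧ X PowerSeries.X)))

noncomputable instance : Module ℂ (ClassicalLimit X) := Module.compHom _ (PowerSeries.C (R := ℂ))

/-- The quotient map onto the classical limit. -/
noncomputable def mk : X →ₗ[ℂ⟦X⟧] ClassicalLimit X :=
  (LinearMap.range (LinearMap.lsmul ℂ⟦X⟧ X PowerSeries.X)).mkQ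

theorem mk_surjective : Function.Surjective (mk : X → ClassicalLimit X) :=
  Submodule.mkQ_surjective _

theorem mk_eq_zero {x : X} : mk x = 0 ↔ ∃ y, (PowerSeries.X : ℂ⟦X⟧) • y = x :=
  Submodule.Quotient.mk_eq_zero _

/-- A series differs from its constant term by a multiple of `λ`. -/
theorem mk_smul (s : ℂ⟦X⟧) (x : X) :
    mk (s • x) = PowerSeries.constantCoeff s • mk x := by
  change _ = PowerSeries.C (PowerSeries.constantCoeff s) • mk x
  rw [← map_smul, ← sub_eq_zero, ← map_sub, ← sub_smul, mk_eq_zero]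
  obtain ⟨t, ht⟩ := PowerSeries.X_dvd_iff.2
    (show PowerSeries.constantCoeff (s - PowerSeries.C (PowerSeries.constantCoeff s)) = 0 by simp)
  exact ⟨t • x, by rw [ht, mul_smul]⟩

theorem smul_mk (c : ℂ) (x : X) : c • (mk x : ClassicalLimit X) = mk (PowerSeries.C c • x) :=
  (map_smul mk (PowerSeries.C c) x).symm

/-- An endomorphism of `X` induces one of the classical limit. -/
noncomputable def map (T : Module.End ℂ⟦X⟧ X) : Module.End ℂ (ClassicalLimit X) :=
  let S : ClassicalLimit X →ₗ[ℂ⟦X⟧] ClassicalLimit X := Submodule.mapQ _ _ T <| by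
    rintro _ ⟨x, rfl⟩
    exact ⟨T x, by simp⟩
  { toFun := S
    map_add' := map_add S
    map_smul' := fun c => map_smul S (PowerSeries.C c) }

theorem map_mk (T : Module.End ℂ⟦X⟧ X) (x : X) : map T (mk x) = mk (T x) := rfl

end ClassicalLimit

/-- The map `π` exhibits the `*`-algebra `B₀` over `ℂ` as the quotient of the `*`-algebra `B` over
`ℂ[[λ]]` by `λB`. -/
structure IsClassicalLimit {B B₀ : Type*} [Ring B] [Algebra ℂ⟦X⟧ B] [StarRing B] [Ring B₀]
    [Algebra ℂ B₀] [StarRing B₀] (π : B →+* B₀) : Prop where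
  surjective : Function.Surjective π
  map_smul : ∀ (s : ℂ⟦X⟧) b, π (s • b) = PowerSeries.constantCoeff s • π b
  map_star : ∀ b, π (star b) = star (π b)
  eq_smul : ∀ b, π b = 0 → ∃ b', b = (PowerSeries.X : ℂ⟦X⟧) • b'

namespace IsClassicalLimit

variable {B B₀ X : Type*} [Ring B] [Algebra ℂ⟦X⟧ B] [StarRing B] [Ring B₀] [Algebra ℂ B₀]
  [StarRing B₀] [AddCommGroup X] [Module ℂ⟦X⟧ X] {π : B →+* B₀} (h : IsClassicalLimit π)

/-- This makes the induced action independent of the chosen representatives. -/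
theorem map_eq_of_eq (h : IsClassicalLimit π)
    (F : B →ₗ[ℂ⟦X⟧] Module.End ℂ⟦X⟧ X) {b b' : B} (hb : π b = π b') (x : X) :
    ClassicalLimit.mk (F b x) = ClassicalLimit.mk (F b' x) := by
  obtain ⟨c, hc⟩ := h.eq_smul (b - b') (by rw [map_sub, hb, sub_self])
  rw [← sub_eq_zero, ← map_sub, ← LinearMap.sub_apply, ← map_sub, hc, _root_.map_smul,
    LinearMap.smul_apply, ClassicalLimit.mk_smul, PowerSeries.constantCoeff_X, zero_smul]

/-- An action of `B` on `X` induces an action of `B₀` on the classical limit of `X`. -/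
noncomputable def action (F : B →ₗ[ℂ⟦X⟧] Module.End ℂ⟦X⟧ X) :
    B₀ →ₗ[ℂ] Module.End ℂ (ClassicalLimit X) where
  toFun b := ClassicalLimit.map (F (Function.surjInv h.surjective b))
  map_add' b b' := by
    ext x
    obtain ⟨x, rfl⟩ := ClassicalLimit.mk_surjective x
    rw [LinearMap.add_apply, ClassicalLimit.map_mk, ClassicalLimit.map_mk, ClassicalLimit.map_mk,
      ← map_add, ← LinearMap.add_apply, ← map_add]
    exact h.map_eq_of_eq F (by simp [Function.surjInv_eq]) x
  map_smul' c b := by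
    ext x
    obtain ⟨x, rfl⟩ := ClassicalLimit.mk_surjective x
    have hc : c = PowerSeries.constantCoeff (PowerSeries.C c) := by simp
    rw [RingHom.id_apply, LinearMap.smul_apply, ClassicalLimit.map_mk, ClassicalLimit.map_mk]
    conv_rhs => rw [hc, ← ClassicalLimit.mk_smul, ← LinearMap.smul_apply, ← _root_.map_smul]
    exact h.map_eq_of_eq F (by simp [Function.surjInv_eq, h.map_smul]) x

theorem action_mk (F : B →ₗ[ℂ⟦X⟧] Module.End ℂ⟦X⟧ X) (b : B) (x : X) :
    h.action F (π b) (ClassicalLimit.mk x) = ClassicalLimit.mk (F b x) :=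
  h.map_eq_of_eq F (Function.surjInv_eq h.surjective _) x

end IsClassicalLimit

/-! ### The inner product bimodule modulo `λ` -/

namespace InnerBimodule

variable {B A B₀ A₀ X : Type*} [Ring B] [Algebra ℂ⟦X⟧ B] [StarRing B] [Ring B₀]
  [Algebra ℂ B₀] [StarRing B₀] [Ring A] [Algebra ℂ⟦X⟧ A] [StarRing A] [Ring A₀]
  [Algebra ℂ A₀] [StarRing A₀] [AddCommGroup X] [Module ℂ⟦X⟧ X] {π : B →+* B₀} {ρ : A →+* A₀}
  (E : InnerBimodule ℂ⟦X⟧ B A X) (hπ : IsClassicalLimit π) (hρ : IsClassicalLimit ρ)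

/-- Linearity handles the second argument; the symmetry `innerA_star` carries the result over to the
first. -/
theorem map_innerA_eq (hρ : IsClassicalLimit ρ) {x x' y y' : X}
    (hx : ClassicalLimit.mk x = ClassicalLimit.mk x')
    (hy : ClassicalLimit.mk y = ClassicalLimit.mk y') :
    ρ (E.innerA x y) = ρ (E.innerA x' y') := by
  have h : ∀ x y y' : X, ClassicalLimit.mk y = ClassicalLimit.mk y' →
      ρ (E.innerA x y) = ρ (E.innerA x y') := fun x y y' hy => by
    rw [← sub_eq_zero, ← map_sub, ClassicalLimit.mk_eq_zero] at hy
    obtain ⟨z, hz⟩ := hy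
    rw [← sub_add_cancel y y', ← hz, innerA_add_right, innerA_smul_right, map_add, hρ.map_smul,
      PowerSeries.constantCoeff_X, zero_smul, zero_add]
  rw [h x y y' hy, E.innerA_star, hρ.map_star, h y' x x' hx, ← hρ.map_star, ← E.innerA_star]

theorem map_innerB_eq (hπ : IsClassicalLimit π) {x x' y y' : X}
    (hx : ClassicalLimit.mk x = ClassicalLimit.mk x')
    (hy : ClassicalLimit.mk y = ClassicalLimit.mk y') :
    π (E.innerB x y) = π (E.innerB x' y') := by
  have h : ∀ x x' y : X, ClassicalLimit.mk x = ClassicalLimit.mk x' →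
      π (E.innerB x y) = π (E.innerB x' y) := fun x x' y hx => by
    rw [← sub_eq_zero, ← map_sub, ClassicalLimit.mk_eq_zero] at hx
    obtain ⟨z, hz⟩ := hx
    rw [← sub_add_cancel x x', ← hz, innerB_add_left, innerB_smul_left, map_add, hπ.map_smul,
      PowerSeries.constantCoeff_X, zero_smul, zero_add]
  rw [h x x' y hx, E.innerB_star, hπ.map_star, h y y' x' hy, ← hπ.map_star, ← E.innerB_star]

theorem map_innerA_out (hρ : IsClassicalLimit ρ) (x y : X) :
    ρ (E.innerA (Function.surjInv ClassicalLimit.mk_surjective (ClassicalLimit.mk x))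
      (Function.surjInv ClassicalLimit.mk_surjective (ClassicalLimit.mk y))) =
        ρ (E.innerA x y) :=
  E.map_innerA_eq hρ (Function.surjInv_eq _ _) (Function.surjInv_eq _ _)

theorem map_innerB_out (hπ : IsClassicalLimit π) (x y : X) :
    π (E.innerB (Function.surjInv ClassicalLimit.mk_surjective (ClassicalLimit.mk x))
      (Function.surjInv ClassicalLimit.mk_surjective (ClassicalLimit.mk y))) =
        π (E.innerB x y) :=
  E.map_innerB_eq hπ (Function.surjInv_eq _ _) (Function.surjInv_eq _ _)

/-- The classical limit of an inner product bimodule. -/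
noncomputable def classicalLimit : InnerBimodule ℂ B₀ A₀ (ClassicalLimit X) where
  left := hπ.action E.left
  left_mul b b' x := by
    obtain ⟨b, rfl⟩ := hπ.surjective b
    obtain ⟨b', rfl⟩ := hπ.surjective b'
    obtain ⟨x, rfl⟩ := ClassicalLimit.mk_surjective x
    simp only [← map_mul, hπ.action_mk, E.left_mul]
  right := hρ.action E.right
  right_mul a a' x := by
    obtain ⟨a, rfl⟩ := hρ.surjective a
    obtain ⟨a', rfl⟩ := hρ.surjective a'
    obtain ⟨x, rfl⟩ := ClassicalLimit.mk_surjective x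
    simp only [← map_mul, hρ.action_mk, E.right_mul]
  left_right_comm b a x := by
    obtain ⟨b, rfl⟩ := hπ.surjective b
    obtain ⟨a, rfl⟩ := hρ.surjective a
    obtain ⟨x, rfl⟩ := ClassicalLimit.mk_surjective x
    simp only [hπ.action_mk, hρ.action_mk, E.left_right_comm]
  innerA x y := ρ (E.innerA (Function.surjInv ClassicalLimit.mk_surjective x)
    (Function.surjInv ClassicalLimit.mk_surjective y))
  innerA_linear s t x y z := by
    obtain ⟨x, rfl⟩ := ClassicalLimit.mk_surjective x
    obtain ⟨y, rfl⟩ := ClassicalLimit.mk_surjective y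
    obtain ⟨z, rfl⟩ := ClassicalLimit.mk_surjective z
    simp only [ClassicalLimit.smul_mk, ← map_add, map_innerA_out E hρ, E.innerA_linear]
    rw [map_add, hρ.map_smul, hρ.map_smul, PowerSeries.constantCoeff_C,
      PowerSeries.constantCoeff_C]
  innerA_star x y := by rw [E.innerA_star, hρ.map_star]
  innerA_right x y a := by
    obtain ⟨a, rfl⟩ := hρ.surjective a
    obtain ⟨x, rfl⟩ := ClassicalLimit.mk_surjective x
    obtain ⟨y, rfl⟩ := ClassicalLimit.mk_surjective y
    simp only [hρ.action_mk, map_innerA_out E hρ, E.innerA_right, map_mul]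
  innerA_left x y b := by
    obtain ⟨b, rfl⟩ := hπ.surjective b
    obtain ⟨x, rfl⟩ := ClassicalLimit.mk_surjective x
    obtain ⟨y, rfl⟩ := ClassicalLimit.mk_surjective y
    simp only [hπ.action_mk, map_innerA_out E hρ, E.innerA_left, ← hπ.map_star]
  innerA_full := by
    rw [eq_top_iff]
    rintro a -
    obtain ⟨a, rfl⟩ := hρ.surjective a
    induction a using E.inductionA with
    -- Scalars in `ℂ[[λ]]` act on the quotient through their constant terms, so a span over `ℂ[[λ]]`
    -- maps into the span over `ℂ`.
    | inner x y => exact Submodule.subset_span ⟨_, _, (map_innerA_out E hρ x y).symm⟩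
    | add a a' h h' => rw [map_add]; exact add_mem h h'
    | smul s a h => rw [hρ.map_smul]; exact Submodule.smul_mem _ _ h
  innerB x y := π (E.innerB (Function.surjInv ClassicalLimit.mk_surjective x)
    (Function.surjInv ClassicalLimit.mk_surjective y))
  innerB_linear s t x y z := by
    obtain ⟨x, rfl⟩ := ClassicalLimit.mk_surjective x
    obtain ⟨y, rfl⟩ := ClassicalLimit.mk_surjective y
    obtain ⟨z, rfl⟩ := ClassicalLimit.mk_surjective z
    simp only [ClassicalLimit.smul_mk, ← map_add, map_innerB_out E hπ, E.innerB_linear]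
    rw [map_add, hπ.map_smul, hπ.map_smul, PowerSeries.constantCoeff_C,
      PowerSeries.constantCoeff_C]
  innerB_star x y := by rw [E.innerB_star, hπ.map_star]
  innerB_left b x y := by
    obtain ⟨b, rfl⟩ := hπ.surjective b
    obtain ⟨x, rfl⟩ := ClassicalLimit.mk_surjective x
    obtain ⟨y, rfl⟩ := ClassicalLimit.mk_surjective y
    simp only [hπ.action_mk, map_innerB_out E hπ, E.innerB_left, map_mul]
  innerB_right x y a := by
    obtain ⟨a, rfl⟩ := hρ.surjective a
    obtain ⟨x, rfl⟩ := ClassicalLimit.mk_surjective x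
    obtain ⟨y, rfl⟩ := ClassicalLimit.mk_surjective y
    simp only [hρ.action_mk, map_innerB_out E hπ, E.innerB_right, ← hρ.map_star]
  innerB_full := by
    rw [eq_top_iff]
    rintro b -
    obtain ⟨b, rfl⟩ := hπ.surjective b
    induction b using E.inductionB with
    | inner x y => exact Submodule.subset_span ⟨_, _, (map_innerB_out E hπ x y).symm⟩
    | add b b' h h' => rw [map_add]; exact add_mem h h'
    | smul s b h => rw [hπ.map_smul]; exact Submodule.smul_mem _ _ h
  compat x y z := by
    obtain ⟨x, rfl⟩ := ClassicalLimit.mk_surjective x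
    obtain ⟨y, rfl⟩ := ClassicalLimit.mk_surjective y
    obtain ⟨z, rfl⟩ := ClassicalLimit.mk_surjective z
    rw [map_innerA_out E hρ, map_innerB_out E hπ, hπ.action_mk, hρ.action_mk, E.compat]

end InnerBimodule

/-! ### The undeformed algebra as classical limit of a star product -/

namespace HermitianStarProduct

variable {m : ℕ} {M : Type*} [TopologicalSpace M] [ChartedSpace (EuclideanSpace ℝ (Fin m)) M]
  {P : PoissonStructure m M} (S : HermitianStarProduct P)

/-- The zeroth coefficient, as a ring homomorphism to the undeformed algebra. -/
noncomputable def zerothCoeff : S.Alg →+* SmoothFun m M where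
  toFun f := PowerSeries.coeff (R := SmoothFun m M) 0 f
  map_one' := PowerSeries.coeff_zero_one
  map_zero' := map_zero (PowerSeries.coeff (R := SmoothFun m M) 0)
  map_add' := map_add (PowerSeries.coeff (R := SmoothFun m M) 0)
  map_mul' f g := by
    refine (coeff_starMul S.C f g 0).trans ?_
    simp [S.zeroth]

theorem isClassicalLimit_zerothCoeff : IsClassicalLimit S.zerothCoeff where
  surjective f := ⟨PowerSeries.C f, PowerSeries.coeff_zero_C f⟩
  map_smul s f := (coeff_series_smul s f 0).trans (by simp [zerothCoeff])
  map_star f := PowerSeries.coeff_mk 0 fun k =>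
    star (PowerSeries.coeff (R := SmoothFun m M) k f)
  eq_smul f hf := by
    obtain ⟨g, hg⟩ := PowerSeries.X_dvd_iff.2
      (show PowerSeries.constantCoeff (R := SmoothFun m M) f = 0 from
        (PowerSeries.coeff_zero_eq_constantCoeff_apply _).symm.trans hf)
    refine ⟨g, hg.trans ?_⟩
    -- The scalar action on `S.Alg` is that of the undeformed power series, where it agrees with
    -- multiplication by the variable.
    change _ = ((PowerSeries.X : ℂ⟦X⟧) • g : (SmoothFun m M)⟦X⟧)
    rw [Algebra.smul_def, PowerSeries.algebraMap_apply'', PowerSeries.map_X]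

end HermitianStarProduct

theorem mainTheorem12 {m n : ℕ}
    {M : Type*} [TopologicalSpace M] [ChartedSpace (EuclideanSpace ℝ (Fin m)) M]
    [IsManifold (𝓡 m) ∞ M] [T2Space M] [SecondCountableTopology M]
    {N : Type*} [TopologicalSpace N] [ChartedSpace (EuclideanSpace ℝ (Fin n)) N]
    [IsManifold (𝓡 n) ∞ N] [T2Space N] [SecondCountableTopology N] :
    (∀ (X : Type*) [AddCommGroup X] [Module ℂ X],
      Nonempty (InnerBimodule ℂ (SmoothFun m M) (SmoothFun n N) X) →
        Nonempty (M ≃ₘ⟮𝓡 m, 𝓡 n⟯ N)) ∧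
    (∀ (P : PoissonStructure m M) (Q : PoissonStructure n N)
      (S : HermitianStarProduct P) (T : HermitianStarProduct Q)
      (X : Type*) [AddCommGroup X] [Module ℂ⟦X⟧ X],
      Nonempty (InnerBimodule ℂ⟦X⟧ S.Alg T.Alg X) →
        Nonempty (M ≃ₘ⟮𝓡 m, 𝓡 n⟯ N)) := by
  refine ⟨fun X _ _ ⟨E⟩ => E.nonempty_algEquiv.elim SmoothFun.nonempty_diffeomorph,
    fun P Q S T X _ _ ⟨E⟩ => ?_⟩
  exact (E.classicalLimit S.isClassicalLimit_zerothCoeff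
    T.isClassicalLimit_zerothCoeff).nonempty_algEquiv.elim SmoothFun.nonempty_diffeomorph
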